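/- Let $A$ be a (complex, not necessarily unital) C$^*$-algebra. Let $A^{**}$ be its second dual, with the Arens product and the canonical involution (that is, the enveloping von Neumann algebra of $A$), and regard $A$ as a subset of $A^{**}$ through the canonical embedding. Elements $a,b$ of $A^{**}$ are called orthogonal if $ab^*=b^*a=0$. In an algebra $B\in\{A,A^{**}\}$, a minimal projection is a non-zero $p\in B$ with $p=p^*=p^2$ and $pBp=\mathbb{C}p$; a minimal partial isometry is a non-zero $e\in B$ with $ee^*e=e$ such that $ee^*$ is a minimal projection in $B$. Then: (a) every minimal projection $p$ of $A^{**}$ with $p\notin A$ is orthogonal to all minimal projections of $A$; (b) every minimal partial isometry $u$ of $A^{**}$ with $u\notin A$ is orthogonal to all minimal partial isometries of $A$. -/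

import Mathlib

noncomputable section

namespace CStarBidual

/-- The second dual `A**` of a C⋆-algebra `A`, i.e. the Banach dual of the Banach dual of `A`. It
is equipped below with the Arens product and the canonical involution, which make it the enveloping
von Neumann algebra of `A`. -/
abbrev Bidual (A : Type*) [NonUnitalCStarAlgebra A] : Type _ :=
  StrongDual ℂ (StrongDual ℂ A)

variable {A : Type*} [NonUnitalCStarAlgebra A]

/-- The canonical embedding of `A` into `A**`. -/
def incl (a : A) : Bidual A := NormedSpace.inclusionInDoubleDual ℂ A a

theorem incl_apply (a : A) (f : StrongDual ℂ A) : incl a f = f a := rfl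

/-- The right action of `A` on `A*`, as a continuous bilinear map:
`(f · a)(b) = f (a * b)`. -/
def dualAct : StrongDual ℂ A →L[ℂ] A →L[ℂ] StrongDual ℂ A :=
  ((ContinuousLinearMap.compL ℂ A (A →L[ℂ] A) (StrongDual ℂ A)).flip
    (ContinuousLinearMap.mul ℂ A)).comp (ContinuousLinearMap.compL ℂ A A ℂ)

theorem dualAct_apply (f : StrongDual ℂ A) (a b : A) : dualAct f a b = f (a * b) := rfl

/-- The left action of `A**` on `A*`, linear in the functional:
`(n · f)(a) = n (f · a)`. -/
def bidualAct (n : Bidual A) : StrongDual ℂ A →L[ℂ] StrongDual ℂ A :=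
  (ContinuousLinearMap.compL ℂ A (StrongDual ℂ A) ℂ n).comp dualAct

theorem bidualAct_apply (n : Bidual A) (f : StrongDual ℂ A) (a : A) :
    bidualAct n f a = n (dualAct f a) := rfl

/-- The (first) Arens product on `A**`: `(m * n)(f) = m (n · f)`. -/
instance instMulBidual : Mul (Bidual A) :=
  ⟨fun m n => ContinuousLinearMap.comp m (bidualAct n)⟩

theorem bidual_mul_apply (m n : Bidual A) (f : StrongDual ℂ A) :
    (m * n) f = m (bidualAct n f) := rfl

/-- The involution of a functional: `f⋆(a) = conj (f (a⋆))`, conjugate-linear in `f`. -/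
def dualStar : StrongDual ℂ A →L⋆[ℂ] StrongDual ℂ A :=
  LinearMap.mkContinuous
    { toFun := fun f =>
        ((starL ℂ : ℂ ≃L⋆[ℂ] ℂ) : ℂ →L⋆[ℂ] ℂ).comp
          (f.comp ((starL ℂ : A ≃L⋆[ℂ] A) : A →L⋆[ℂ] A))
      map_add' := fun f g => by ext a; simp
      map_smul' := fun c f => by ext a; simp }
    1 (fun f => by
      refine ContinuousLinearMap.opNorm_le_bound _ (by positivity) fun a => ?_
      simpa using f.le_opNorm (star a))

theorem dualStar_apply (f : StrongDual ℂ A) (a : A) : dualStar f a = star (f (star a)) := rfl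

/-- The involution of `A**`: `m⋆(f) = conj (m (f⋆))`. -/
instance instStarBidual : Star (Bidual A) :=
  ⟨fun m => ((starL ℂ : ℂ ≃L⋆[ℂ] ℂ) : ℂ →L⋆[ℂ] ℂ).comp (m.comp (dualStar (A := A)))⟩

theorem bidual_star_apply (m : Bidual A) (f : StrongDual ℂ A) :
    (star m) f = star (m (dualStar f)) := rfl

section Notions

/- The notions below are used both for `A` and for `A**`. -/
variable {B : Type*} [Mul B] [Star B] [Zero B] [SMul ℂ B]

/-- `a ⊥ b`: `a b⋆ = b⋆ a = 0`. -/
def Orthogonal (a b : B) : Prop := a * star b = 0 ∧ star b * a = 0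

/-- A minimal projection: a non-zero self-adjoint idempotent `p` with `p B p = ℂ p`. -/
def IsMinimalProjection (p : B) : Prop :=
  p ≠ 0 ∧ IsStarProjection p ∧
    Set.range (fun x : B => p * x * p) = Set.range (fun c : ℂ => c • p)

/-- A minimal partial isometry: a non-zero `e` with `e e⋆ e = e` (i.e. a partial isometry) such
that the projection `e e⋆` is minimal. -/
def IsMinimalPartialIsometry (e : B) : Prop :=
  e ≠ 0 ∧ e * star e * e = e ∧ IsMinimalProjection (e * star e)

end Notions

end CStarBidual

end

namespace CStarBidual

/-! ### Algebra of the Arens product and its involution. -/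

section Arens

variable {A : Type*} [NonUnitalCStarAlgebra A]

/-! For a minimal projection `q` of `A` the right ideal `qA` is a Hilbert space, hence reflexive, so
`qA**` and, by taking adjoints, `A**q` lie in `A` (`exists_incl_mul_eq`, `exists_mul_incl_eq`). Thus
`c = pq` is in `A` with `pc = c`. Minimality of `p` puts `cc⋆` in `ℂp`, so `c ≠ 0` would force `p ∈
A` (`eq_zero_of_mul_incl_eq`). Part (b) applies the same facts to the range and source projections
of `u` and `v`. -/

theorem incl_injective : Function.Injective (incl : A → Bidual A) :=
  (NormedSpace.inclusionInDoubleDualLi ℂ (E := A)).injective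

theorem incl_smul (c : ℂ) (a : A) : incl (c • a) = c • incl a :=
  map_smul (NormedSpace.inclusionInDoubleDual ℂ A) c a

theorem incl_zero : incl (0 : A) = 0 :=
  map_zero (NormedSpace.inclusionInDoubleDual ℂ A)

theorem incl_mul (a b : A) : incl (a * b) = incl a * incl b := rfl

theorem incl_star (a : A) : incl (star a) = star (incl a) := by
  ext f
  simp [bidual_star_apply, incl_apply, dualStar_apply]

theorem bidual_mul_assoc (l m n : Bidual A) : l * m * n = l * (m * n) := by
  refine ContinuousLinearMap.ext fun f => congrArg l ?_
  refine ContinuousLinearMap.ext fun a => congrArg m ?_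
  refine ContinuousLinearMap.ext fun b => congrArg n ?_
  refine ContinuousLinearMap.ext fun c => congrArg f ?_
  exact mul_assoc a b c

theorem bidual_zero_mul (m : Bidual A) : 0 * m = 0 := rfl

theorem bidual_mul_zero (m : Bidual A) : m * 0 = 0 := by
  refine ContinuousLinearMap.ext fun f => ?_
  have h : bidualAct (0 : Bidual A) f = 0 := rfl
  rw [bidual_mul_apply, h, map_zero]
  rfl

theorem dualStar_dualStar (f : StrongDual ℂ A) : dualStar (dualStar f) = f := by
  ext a
  simp [dualStar_apply]

theorem bidual_star_star (m : Bidual A) : star (star m) = m := by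
  ext f
  simp [bidual_star_apply, dualStar_dualStar]

/-- With one factor in `A`, antimultiplicativity is mere unfolding; no Arens regularity is needed.
-/
theorem star_incl_mul (a : A) (m : Bidual A) :
    star (incl a * m) = star m * incl (star a) := by
  refine ContinuousLinearMap.ext fun f => congrArg (fun g => star (m g)) ?_
  refine ContinuousLinearMap.ext fun b => congrArg star ?_
  exact congrArg f (star_mul a b)

theorem star_mul_incl (m : Bidual A) (a : A) :
    star (m * incl a) = incl (star a) * star m := by
  rw [← bidual_star_star (incl (star a) * star m), star_incl_mul, bidual_star_star, star_star]

end Arens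

/-! ### The Hilbert space `qA`. -/

section Corner

variable {A : Type*} [NonUnitalCStarAlgebra A]

theorem IsMinimalProjection.exists_smul {B : Type*} [Mul B] [Star B] [Zero B] [SMul ℂ B] {p : B}
    (hp : IsMinimalProjection p) (x : B) : ∃ c : ℂ, p * x * p = c • p := by
  have h : p * x * p ∈ Set.range (fun c : ℂ => c • p) := hp.2.2 ▸ ⟨x, rfl⟩
  obtain ⟨c, hc⟩ := h
  exact ⟨c, hc.symm⟩

/-- A multiple of a non-zero projection of the form `x x⋆` is a non-negative multiple. -/
theorem norm_eq_re_of_mul_star_self {q x : A} {c : ℂ} (hq : IsStarProjection q) (hq0 : q ≠ 0)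
    (h : x * star x = c • q) : ‖c‖ = c.re := by
  have hreal : star c = c := by
    have h1 : star (x * star x) = x * star x := by simp
    rw [h, star_smul, hq.isSelfAdjoint.star_eq] at h1
    exact smul_left_injective ℂ hq0 h1
  have hc : c = (c.re : ℂ) := (Complex.conj_eq_iff_re.mp hreal).symm
  have hnn : 0 ≤ c.re := by
    -- If `c < 0`, then `cq = xx⋆` and `-cq = y⋆y` are both positive, so `cq = 0`.
    by_contra! hneg
    let := CStarAlgebra.spectralOrder A
    let := CStarAlgebra.spectralOrderedRing A
    set y : A := ((Real.sqrt (-c.re) : ℝ) : ℂ) • q with hy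
    have hyy : star y * y = -(c • q) := by
      rw [hy, star_smul, hq.isSelfAdjoint.star_eq, smul_mul_smul_comm, hq.isIdempotentElem.eq,
        ← neg_smul]
      congr 1
      rw [Complex.star_def, Complex.conj_ofReal, ← Complex.ofReal_mul,
        Real.mul_self_sqrt (by linarith), Complex.ofReal_neg, ← hc]
    have h1 : 0 ≤ -(c • q) := hyy ▸ star_mul_self_nonneg y
    have h2 : 0 ≤ c • q := h ▸ mul_star_self_nonneg x
    have h3 : c • q = 0 := le_antisymm (neg_nonneg.mp h1) h2
    rcases smul_eq_zero.mp h3 with h4 | h4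
    · simp [h4] at hneg
    · exact hq0 h4
  rw [hc, Complex.norm_real, Real.norm_of_nonneg hnn, Complex.ofReal_re]

/-- The right ideal `q A` of a projection `q`. -/
noncomputable def corner (q : A) : Submodule ℂ A :=
  LinearMap.ker ((ContinuousLinearMap.mul ℂ A q - ContinuousLinearMap.id ℂ A : A →L[ℂ] A) :
    A →ₗ[ℂ] A)

theorem mem_corner {q x : A} : x ∈ corner q ↔ q * x = x := by
  simp [corner, sub_eq_zero]

instance (q : A) : CompleteSpace (corner q) :=
  (ContinuousLinearMap.isClosed_ker
    (ContinuousLinearMap.mul ℂ A q - ContinuousLinearMap.id ℂ A)).completeSpace_coe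

/-- The right ideal `q A` of a minimal projection `q` is a Hilbert space for the norm of `A`: its
inner product is given by `⟪x, y⟫ q = y x⋆`. -/
noncomputable abbrev cornerInnerProductSpace {q : A} (hq : IsMinimalProjection q) :
    InnerProductSpace ℂ (corner q) :=
  have hex : ∀ x y : corner q, ∃ c : ℂ, (y : A) * star (x : A) = c • q := fun x y => by
    obtain ⟨c, hc⟩ := hq.exists_smul ((y : A) * star (x : A))
    refine ⟨c, ?_⟩
    have h1 : star (x : A) * q = star (x : A) := by
      conv_rhs => rw [← mem_corner.mp x.2, star_mul, hq.2.1.isSelfAdjoint.star_eq]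
    rwa [← mul_assoc, mem_corner.mp y.2, mul_assoc, h1] at hc
  have huniq : ∀ {c d : ℂ}, c • q = d • q → c = d := fun h => smul_left_injective ℂ hq.1 h
  { inner := fun x y => (hex x y).choose
    norm_sq_eq_re_inner := fun x => by
      have h := (hex x x).choose_spec
      have hq1 : ‖q‖ = 1 := by
        have h1 := CStarRing.norm_self_mul_star (x := q)
        rw [hq.2.1.isSelfAdjoint.star_eq, hq.2.1.isIdempotentElem.eq] at h1
        exact (mul_eq_left₀ (norm_ne_zero_iff.mpr hq.1)).mp h1.symm
      change ‖(x : A)‖ ^ 2 = (hex x x).choose.re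
      rw [← norm_eq_re_of_mul_star_self hq.2.1 hq.1 h, sq]
      exact CStarRing.norm_self_mul_star.symm.trans <| (congrArg norm h).trans <| by
        rw [norm_smul, hq1, mul_one]
    conj_inner_symm := fun x y => huniq <| by
      have h := congrArg star (hex y x).choose_spec
      rw [star_mul, star_star, star_smul, hq.2.1.isSelfAdjoint.star_eq] at h
      exact h.symm.trans (hex x y).choose_spec
    add_left := fun x y z => huniq <| by
      rw [← (hex (x + y) z).choose_spec, add_smul, ← (hex x z).choose_spec,
        ← (hex y z).choose_spec, Submodule.coe_add, star_add, mul_add]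
    smul_left := fun x y c => huniq <| by
      rw [← (hex (c • x) y).choose_spec, mul_smul, ← (hex x y).choose_spec, Submodule.coe_smul,
        star_smul, mul_smul_comm, Complex.star_def] }

end Corner

/-- Reflexivity, by using the Riesz isometry twice: it turns `n` into a functional on `H`, whose
Riesz vector is `b`. -/
theorem exists_forall_apply_eq_of_hilbert {H : Type*} [NormedAddCommGroup H]
    [InnerProductSpace ℂ H] [CompleteSpace H] (n : StrongDual ℂ (StrongDual ℂ H)) :
    ∃ b : H, ∀ g : StrongDual ℂ H, n g = g b := by
  let ψ : StrongDual ℂ H := (((starL ℂ : ℂ ≃L⋆[ℂ] ℂ) : ℂ →L⋆[ℂ] ℂ).comp n).comp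
    ((InnerProductSpace.toDual ℂ H).toContinuousLinearEquiv : H →L⋆[ℂ] StrongDual ℂ H)
  refine ⟨(InnerProductSpace.toDual ℂ H).symm ψ, fun g => ?_⟩
  obtain ⟨h, rfl⟩ := (InnerProductSpace.toDual ℂ H).surjective g
  rw [InnerProductSpace.toDual_apply_apply, ← inner_conj_symm, InnerProductSpace.toDual_symm_apply]
  exact (star_star (n _)).symm

variable {A : Type*} [NonUnitalCStarAlgebra A]

theorem IsMinimalProjection.exists_incl_mul_eq {q : A} (hq : IsMinimalProjection q)
    (n : Bidual A) : ∃ b : A, incl q * n = incl b := by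
  let := cornerInnerProductSpace hq
  let P : A →L[ℂ] corner q := (ContinuousLinearMap.mul ℂ A q).codRestrict (corner q) fun a =>
    mem_corner.mpr <| by
      rw [ContinuousLinearMap.mul_apply', ← mul_assoc, hq.2.1.isIdempotentElem.eq]
  -- `(qn)(f) = n(f · q)`, and `f · q` is the restriction of `f` to `qA` composed with `P`.
  obtain ⟨b, hb⟩ := exists_forall_apply_eq_of_hilbert
    (n.comp ((ContinuousLinearMap.compL ℂ A (corner q) ℂ).flip P))
  exact ⟨b, ContinuousLinearMap.ext fun f => hb (f.comp (corner q).subtypeL)⟩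

theorem IsMinimalProjection.exists_mul_incl_eq {q : A} (hq : IsMinimalProjection q)
    (n : Bidual A) : ∃ b : A, n * incl q = incl b := by
  obtain ⟨b, hb⟩ := hq.exists_incl_mul_eq (star n)
  refine ⟨star b, ?_⟩
  rw [incl_star, ← hb, star_incl_mul, bidual_star_star, hq.2.1.isSelfAdjoint.star_eq]

/-- If `p` is a minimal projection of `A**` outside `A`, then the only `c` in `A` with `p c = c`
is `0`. -/
theorem IsMinimalProjection.eq_zero_of_mul_incl_eq {p : Bidual A} (hp : IsMinimalProjection p)
    (hpA : p ∉ Set.range (incl : A → Bidual A)) {c : A} (hc : p * incl c = incl c) : c = 0 := by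
  have hc' : incl (star c) * p = incl (star c) := by
    conv_rhs => rw [incl_star, ← hc, star_mul_incl, hp.2.1.isSelfAdjoint.star_eq]
  -- `cc⋆ = p(cc⋆)p = tp`; if `t ≠ 0`, then `p = t⁻¹cc⋆` lies in `A`.
  obtain ⟨t, ht⟩ := hp.exists_smul (incl (c * star c))
  rw [incl_mul, ← bidual_mul_assoc, hc, bidual_mul_assoc, hc', ← incl_mul] at ht
  have ht0 : t = 0 := by
    by_contra h
    exact hpA ⟨t⁻¹ • (c * star c), by rw [incl_smul, ht, smul_smul, inv_mul_cancel₀ h, one_smul]⟩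
  rw [ht0, show (0 : ℂ) • p = incl (0 : A) from (zero_smul ℂ p).trans incl_zero.symm] at ht
  exact CStarRing.mul_star_self_eq_zero_iff c |>.mp (incl_injective ht)

/-- For a partial isometry `v` whose range projection is minimal, so is the source projection. -/
theorem IsMinimalPartialIsometry.isMinimalProjection_star_mul_self {v : A}
    (hv : IsMinimalPartialIsometry v) : IsMinimalProjection (star v * v) := by
  obtain ⟨hv0, hvv, hq⟩ := hv
  have hvv' : star v * v * star v = star v := by
    conv_rhs => rw [← hvv]
    simp [mul_assoc]
  have hr : star v * v * (star v * v) = star v * v := by rw [← mul_assoc, hvv']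
  refine ⟨fun h => hv0 ((CStarRing.star_mul_self_eq_zero_iff v).mp h),
    ⟨hr, IsSelfAdjoint.star_mul_self v⟩, Set.Subset.antisymm ?_ ?_⟩
  · rintro _ ⟨x, rfl⟩
    obtain ⟨c, hc⟩ := hq.exists_smul (v * x * star v)
    refine ⟨c, ?_⟩
    -- Conjugation by `v` carries the corner of `v⋆v` to that of `vv⋆`.
    have h1 : star v * (v * star v * (v * x * star v) * (v * star v)) * v
        = (star v * v * star v) * v * x * star v * (v * star v * v) := by
      simp only [mul_assoc]
    rw [hc, hvv, hvv', mul_smul_comm, smul_mul_assoc, ← mul_assoc, hvv'] at h1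
    simp only [h1, mul_assoc]
  · rintro _ ⟨c, rfl⟩
    refine ⟨c • (star v * v), ?_⟩
    simp only [mul_smul_comm, smul_mul_assoc, hr]

theorem isMinimalProjection_of_incl {a : A} (ha : IsMinimalProjection (incl a)) :
    IsMinimalProjection a := by
  have hidem : a * a = a := incl_injective ha.2.1.isIdempotentElem
  refine ⟨fun h => ha.1 (by rw [h, incl_zero]), ⟨hidem, incl_injective ?_⟩,
    Set.Subset.antisymm ?_ ?_⟩
  · rw [incl_star, ha.2.1.isSelfAdjoint.star_eq]
  · rintro _ ⟨x, rfl⟩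
    obtain ⟨c, hc⟩ := ha.exists_smul (incl x)
    exact ⟨c, incl_injective (by rw [incl_smul, ← hc]; rfl)⟩
  · rintro _ ⟨c, rfl⟩
    refine ⟨c • a, ?_⟩
    simp only [mul_smul_comm, smul_mul_assoc, hidem]

theorem IsMinimalProjection.orthogonal_incl {p : Bidual A} (hp : IsMinimalProjection p)
    (hpA : p ∉ Set.range (incl : A → Bidual A)) {q : A} (hq : IsMinimalProjection q) :
    Orthogonal p (incl q) := by
  obtain ⟨b, hb⟩ := hq.exists_mul_incl_eq p
  have hb0 : b = 0 := hp.eq_zero_of_mul_incl_eq hpA <| by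
    rw [← hb, ← bidual_mul_assoc, hp.2.1.isIdempotentElem.eq]
  rw [hb0, incl_zero] at hb
  rw [Orthogonal, ← incl_star, hq.2.1.isSelfAdjoint.star_eq]
  refine ⟨hb, ?_⟩
  have h := congrArg star hb
  rw [star_mul_incl, hq.2.1.isSelfAdjoint.star_eq, hp.2.1.isSelfAdjoint.star_eq, ← incl_zero,
    ← incl_star, star_zero, incl_zero] at h
  exact h

theorem IsMinimalPartialIsometry.orthogonal_incl {u : Bidual A} (hu : IsMinimalPartialIsometry u)
    (huA : u ∉ Set.range (incl : A → Bidual A)) {v : A} (hv : IsMinimalPartialIsometry v) :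
    Orthogonal u (incl v) := by
  have hr := hv.isMinimalProjection_star_mul_self
  obtain ⟨-, huu, hp⟩ := hu
  obtain ⟨-, hvv, hq⟩ := hv
  have hvv' : star v * v * star v = star v := by
    conv_rhs => rw [← hvv]
    simp [mul_assoc]
  -- Otherwise `u = (uu⋆)u` would lie in `(uu⋆)A** ⊆ A`.
  have hpA : u * star u ∉ Set.range (incl : A → Bidual A) := by
    rintro ⟨a, ha⟩
    have ha_min : IsMinimalProjection a := isMinimalProjection_of_incl (ha ▸ hp)
    obtain ⟨b, hb⟩ := ha_min.exists_incl_mul_eq u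
    exact huA ⟨b, by rw [← hb, ha, huu]⟩
  rw [Orthogonal, ← incl_star]
  constructor
  -- `c = u(v⋆v)` is in `A` and fixed by `uu⋆`, so it vanishes; then `uv⋆ = u(v⋆v)v⋆ = 0`.
  · obtain ⟨c, hc⟩ := hr.exists_mul_incl_eq u
    have hc0 : c = 0 := hp.eq_zero_of_mul_incl_eq hpA <| by
      rw [← hc, ← bidual_mul_assoc, huu]
    rw [← hvv', incl_mul, ← bidual_mul_assoc, hc, hc0, incl_zero, bidual_zero_mul]
  -- `v⋆u = v⋆(vv⋆)(uu⋆)u`, whose middle product is zero by (a).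
  · have h := (hp.orthogonal_incl hpA hq).2
    rw [← incl_star, hq.2.1.isSelfAdjoint.star_eq] at h
    rw [← hvv', mul_assoc, incl_mul, bidual_mul_assoc, ← huu, ← bidual_mul_assoc (incl (v * star v)),
      h, bidual_zero_mul, bidual_mul_zero]

end CStarBidual

theorem lemma2p4 {A : Type*} [NonUnitalCStarAlgebra A] :
    (∀ p : CStarBidual.Bidual A, CStarBidual.IsMinimalProjection p →
      p ∉ Set.range (CStarBidual.incl : A → CStarBidual.Bidual A) →
      ∀ q : A, CStarBidual.IsMinimalProjection q →
        CStarBidual.Orthogonal p (CStarBidual.incl q)) ∧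
    (∀ u : CStarBidual.Bidual A, CStarBidual.IsMinimalPartialIsometry u →
      u ∉ Set.range (CStarBidual.incl : A → CStarBidual.Bidual A) →
      ∀ v : A, CStarBidual.IsMinimalPartialIsometry v →
        CStarBidual.Orthogonal u (CStarBidual.incl v)) := by
  exact ⟨fun _ hp hpA _ hq => hp.orthogonal_incl hpA hq,
    fun _ hu huA _ hv => hu.orthogonal_incl huA hv⟩
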